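/- Let $\mathrm{Herm}(n)$ be the real vector space of $n\times n$ complex Hermitian matrices with the Frobenius norm $\|\cdot\|$, and write $\lambda_1\le\dots\le\lambda_n$ for the ordered eigenvalues of such a matrix. Let $\Sigma_2\subset\mathrm{Herm}(n)$ be the submanifold of twofold ground-state degenerate matrices, i.e. those with $\lambda_1=\lambda_2<\lambda_3$ (for $n=2$: $\lambda_1=\lambda_2$), and $\mathrm{cl}(\Sigma_2)$ its closure. For a smooth ($C^\infty$) map $H$ from a 3-manifold $M$ (or from an open subset of it) to $\mathrm{Herm}(n)$, a point $p$ with $H(p)\in\mathrm{cl}(\Sigma_2)$ is called a (ground-state) degeneracy point of $H$, and $p$ is called a Weyl point of $H$ if $H(p)\in\Sigma_2$ and $H$ is transverse to $\Sigma_2$ at $p$, i.e. $T_{H(p)}\Sigma_2+(\mathrm{d}H)_p(T_pM)=\mathrm{Herm}(n)$. **Corollary (Weyl points are stable and generic).** Let $M$ be a smooth 3-manifold, $H:M\to\mathrm{Herm}(n)$ a smooth map and $p_0\in M$ with $H(p_0)\in\Sigma_2$. Let $\mathcal W_0\subset M$ be an open neighbourhood of $p_0$ whose closure $\mathrm{cl}(\mathcal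 W_0)$ is compact and satisfies $H^{-1}(\mathrm{cl}(\Sigma_2))\cap\mathrm{cl}(\mathcal W_0)=\{p_0\}$. (a) Suppose that $p_0$ is a Weyl point of $H$. Let $(p,t)\mapsto H_t(p)\in\mathrm{Herm}(n)$ be a one-parameter perturbation of $H$, that is, a smooth map defined on an open set $\Omega\subset M\times\mathbb R$ containing $\mathrm{cl}(\mathcal W_0)\times\{0\}$, such that $H_0(p)=H(p)$ for all $(p,0)\in\Omega$. Then there are an $\epsilon>0$ with $\mathcal W_0\times(-\epsilon,\epsilon)\subset\Omega$ and a $C^\infty$ curve $\gamma:(-\epsilon,\epsilon)\to M$ such that for every $|t|<\epsilon$ the map $H_t$ has exactly one degeneracy point in $\mathcal W_0$, namely $\gamma(t)$, and $\gamma(t)$ is a Weyl point of $H_t$. (b) If $p_0$ is not a Weyl point of $H$, then for every $\epsilon>0$ there is a $K\in\mathrm{Herm}(n)$ with $\|K\|<\epsilon$ such that every degeneracy point in $\mathcal W_0$ of the map $p\mapsto H(p)+K$ is a Weyl point of this map. -/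

import Mathlib

open Set Topology
open scoped Manifold ContDiff

/-- The real vector space of `n × n` complex Hermitian matrices. -/
def Herm (n : ℕ) : Type :=
  selfAdjoint.submodule ℝ (Matrix (Fin n) (Fin n) ℂ)

section Frobenius

attribute [local instance] Matrix.frobeniusNormedAddCommGroup Matrix.frobeniusNormedSpace

/-- Hermitian matrices carry the Frobenius norm. -/
noncomputable instance Herm.instNormedAddCommGroup (n : ℕ) : NormedAddCommGroup (Herm n) :=
  Submodule.normedAddCommGroup (selfAdjoint.submodule ℝ (Matrix (Fin n) (Fin n) ℂ))

noncomputable instance Herm.instNormedSpace (n : ℕ) : NormedSpace ℝ (Herm n) :=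
  Submodule.normedSpace (selfAdjoint.submodule ℝ (Matrix (Fin n) (Fin n) ℂ))

end Frobenius

/-- The underlying matrix of an element of `Herm n`. -/
def Herm.toMatrix {n : ℕ} (A : Herm n) : Matrix (Fin n) (Fin n) ℂ := Subtype.val A

theorem Herm.isHermitian {n : ℕ} (A : Herm n) : A.toMatrix.IsHermitian := Subtype.property A

/-- The eigenvalues of a Hermitian matrix, listed with multiplicity in increasing order:
`ordEig A 0 ≤ ordEig A 1 ≤ …`. (Mathlib's `eigenvalues₀` lists them in decreasing order.) -/
noncomputable def ordEig {n : ℕ} (A : Herm n) (i : Fin n) : ℝ :=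
  A.isHermitian.eigenvalues₀ (Fin.cast (Fintype.card_fin n).symm i.rev)

/-- The set of `k`-fold ground-state degenerate Hermitian matrices
(`λ₁ = … = λ_k < λ_{k+1} ≤ …`; for `k = n` the strict inequality is void). -/
def groundDeg (n k : ℕ) : Set (Herm n) :=
  {A | k ≤ n ∧
    (∀ i j : Fin n, i.val < k → j.val < k → ordEig A i = ordEig A j) ∧
    (∀ i j : Fin n, i.val < k → k ≤ j.val → ordEig A i < ordEig A j)}

/-- The tangent vectors at `x` to a subset `Z` of a normed space: the velocities at time `0` of
smooth curves which start at `x` and stay in `Z` for small times. If `Z` is a smooth submanifold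
and `x ∈ Z`, this is the tangent space of `Z` at `x`. -/
def tangentVectors {E : Type*} [NormedAddCommGroup E] [NormedSpace ℝ E]
    (Z : Set E) (x : E) : Set E :=
  {v | ∃ c : ℝ → E, ContDiff ℝ ∞ c ∧ c 0 = x ∧ (∀ᶠ t in 𝓝 (0 : ℝ), c t ∈ Z) ∧ HasDerivAt c v 0}

/-- A map `f` from a 3-manifold to a normed space `E` is transverse to `Z ⊆ E` at `p`, where
`f p ∈ Z`, if `T_{f p} Z + df_p (T_p M) = E`. -/
def TransverseAt {E : Type*} [NormedAddCommGroup E] [NormedSpace ℝ E]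
    {M : Type*} [TopologicalSpace M] [ChartedSpace (EuclideanSpace ℝ (Fin 3)) M]
    (f : M → E) (Z : Set E) (p : M) : Prop :=
  ∀ v : E, ∃ u ∈ tangentVectors Z (f p), ∃ w : TangentSpace (𝓡 3) p,
    v = u + (show E from mfderiv (𝓡 3) 𝓘(ℝ, E) f p w)

/-- `p` is a ground-state degeneracy point of `H`: the two lowest eigenvalues of `H p` coincide,
that is, `H p` lies in the closure of the set of twofold ground-state degenerate matrices. -/
def IsDegeneracyPoint {n : ℕ} {M : Type*} (H : M → Herm n) (p : M) : Prop :=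
  H p ∈ closure (groundDeg n 2)

/-- `p` is a Weyl point of `H`: a (strictly) twofold ground-state degeneracy point at which `H` is
transverse to the set of twofold ground-state degenerate matrices. -/
def IsWeylPoint {n : ℕ} {M : Type*} [TopologicalSpace M]
    [ChartedSpace (EuclideanSpace ℝ (Fin 3)) M] (H : M → Herm n) (p : M) : Prop :=
  H p ∈ groundDeg n 2 ∧ TransverseAt H (groundDeg n 2) p

/-! Near a twofold degenerate `A₀` the set Σ₂ is a smooth graph of codimension 3: there are a linear
`S : ℝ³ → Herm n` and a smooth `κ` near `A₀` such that, for small `k`, `A + S k` lies in Σ₂ iff `κ A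
= k` (`exists_isLocalGraph_groundDeg`). Hence Σ₂ is locally `{κ = 0}`, its tangent space is `ker
dκ`, and in a chart `f` is transverse to Σ₂ at `p` iff the 3×3 derivative of `κ ∘ f` is invertible
(`transverseAt_iff_chart`). For (a), the implicit function theorem solves `κ (H_t p) = 0` near `p₀`
by a smooth curve, and compactness excludes degeneracies on the rest of `cl W₀`
(`stable_of_transverseAt`). For (b), `κ (H + S k) = κ H - k` near the degeneracy points, so a small
regular value `k` of `κ ∘ H`, given by Sard's theorem, makes all of them transverse
(`exists_translate_transverseAt`). The graph comes from a Schur complement argument. Let `V` be an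
isometry onto the ground space of `A₀` and `S k = V (pauli k) Vᴴ`. For `B = A + S k - λ`, the matrix
`B + V Vᴴ` is positive definite near the base point, and `B` has a two-dimensional kernel iff `Vᴴ (B
+ V Vᴴ)⁻¹ V = 1`. These are four real equations, whose derivative in `(λ, k)` is the identity at the
base point; solving them gives `(λ, k)` as a smooth function of `A`, and `κ` is its second
component. -/

/-! ### Implicit function theorem. -/

section ImplicitFunction

variable {X Y F : Type*} [NormedAddCommGroup X] [NormedSpace ℝ X]
  [NormedAddCommGroup Y] [NormedSpace ℝ Y] [CompleteSpace Y]
  [NormedAddCommGroup F] [NormedSpace ℝ F]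

/-- Invertibility of the partial derivative persists in a neighbourhood. -/
theorem eventually_isInvertible_fderiv_inr {f : X × Y → F} {u : X × Y}
    (hf : ContDiffAt ℝ ∞ f u)
    (hi : (fderiv ℝ f u ∘L .inr ℝ X Y).IsInvertible) :
    ∀ᶠ v in 𝓝 u, (fderiv ℝ f v ∘L .inr ℝ X Y).IsInvertible := by
  have hc : ContinuousAt (fun v => fderiv ℝ f v ∘L .inr ℝ X Y) u :=
    (hf.continuousAt_fderiv (by simp)).clm_comp continuousAt_const
  have ho : IsOpen {T : Y →L[ℝ] F | T.IsInvertible} := ContinuousLinearEquiv.isOpen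
  exact hc.eventually (ho.mem_nhds hi)

/-- The implicit function theorem, with an implicit function that is smooth in a
neighbourhood of the base point. -/
theorem exists_smooth_implicitFunction [CompleteSpace X] [CompleteSpace F] {f : X × Y → F} {u : X × Y}
    (hf : ∀ᶠ v in 𝓝 u, ContDiffAt ℝ ∞ f v)
    (hi : (fderiv ℝ f u ∘L .inr ℝ X Y).IsInvertible) :
    ∃ g : X → Y, g u.1 = u.2 ∧ (∀ᶠ x in 𝓝 u.1, ContDiffAt ℝ ∞ g x) ∧
      ∀ᶠ v in 𝓝 u, (f v = f u ↔ g v.1 = v.2) := by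
  have hu := hf.self_of_nhds
  have hn : (∞ : WithTop ℕ∞) ≠ 0 := by simp
  set g := hu.implicitFunction hn hi with hg
  have hgu : g u.1 = u.2 := hu.implicitFunction_apply_self hn hi
  have hgs : ContDiffAt ℝ ∞ g u.1 := hu.contDiffAt_implicitFunction hn hi
  have hiff : ∀ᶠ v in 𝓝 u, (f v = f u ↔ g v.1 = v.2) :=
    hu.eventually_apply_eq_iff_implicitFunction hn hi
  refine ⟨g, hgu, ?_, hiff⟩
  have hgc : ∀ᶠ x in 𝓝 u.1, ContinuousAt g x := by
    have h1 : ContDiffAt ℝ 1 g u.1 := hgs.of_le (by norm_cast)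
    exact (h1.eventually (by simp)).mono fun x hx => hx.continuousAt
  have hgraph : Filter.Tendsto (fun x => (x, g x)) (𝓝 u.1) (𝓝 u) := by
    have := continuousAt_id.prodMk hgs.continuousAt
    simpa [ContinuousAt, hgu] using this
  filter_upwards [hgc, hgraph.eventually hf,
    hgraph.eventually (eventually_isInvertible_fderiv_inr hu hi),
    hgraph.eventually hiff.eventually_nhds] with x hx1 hx2 hx3 hx4
  have hval : f (x, g x) = f u := hx4.self_of_nhds.2 rfl
  -- The theorem is applied again at `(x, g x)`. Both implicit functions describe the same level set
  -- near that point, so they agree near `x`, and `g` inherits smoothness.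
  have hiff' := hx2.eventually_apply_eq_iff_implicitFunction hn hx3
  refine (hx2.contDiffAt_implicitFunction hn hx3).congr_of_eventuallyEq ?_
  have hgraph' : Filter.Tendsto (fun x => (x, g x)) (𝓝 x) (𝓝 (x, g x)) :=
    continuousAt_id.prodMk hx1
  filter_upwards [hgraph'.eventually hiff', hgraph'.eventually hx4] with y hy1 hy2
  rw [hval] at hy1
  exact (hy1.1 (hy2.2 rfl)).symm

end ImplicitFunction

/-! ### Local graphs of codimension three: tangent space and transversality. -/

theorem isInvertible_iff_surjective {E : Type*} [NormedAddCommGroup E] [NormedSpace ℝ E]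
    [FiniteDimensional ℝ E] (T : E →L[ℝ] E) : T.IsInvertible ↔ Function.Surjective T := by
  refine ⟨fun ⟨e, he⟩ => he ▸ e.surjective, fun h => ?_⟩
  have hi : Function.Injective (T : E →ₗ[ℝ] E) := LinearMap.injective_iff_surjective.2 h
  exact ⟨(LinearEquiv.ofBijective (T : E →ₗ[ℝ] E) ⟨hi, h⟩).toContinuousLinearEquiv, by ext; rfl⟩

/-- Near `U`, the set `Z` is a smooth graph over a complement of the range of `S`:
moving `A ∈ U` by `S k` with `k` small leads into `Z` exactly for `k = κ A`. -/
structure IsLocalGraph {E : Type*} [NormedAddCommGroup E] [NormedSpace ℝ E] (Z U : Set E)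
    (S : EuclideanSpace ℝ (Fin 3) →L[ℝ] E) (κ : E → EuclideanSpace ℝ (Fin 3)) (δ : ℝ) : Prop where
  isOpen : IsOpen U
  pos : 0 < δ
  smooth : ∀ A ∈ U, ContDiffAt ℝ ∞ κ A
  add_mem_iff : ∀ A ∈ U, ∀ k, ‖k‖ < δ → (A + S k ∈ Z ↔ κ A = k)

namespace IsLocalGraph

variable {E : Type*} [NormedAddCommGroup E] [NormedSpace ℝ E] {Z U : Set E}
  {S : EuclideanSpace ℝ (Fin 3) →L[ℝ] E} {κ : E → EuclideanSpace ℝ (Fin 3)} {δ : ℝ}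

theorem mem_iff (h : IsLocalGraph Z U S κ δ) {A : E} (hA : A ∈ U) : A ∈ Z ↔ κ A = 0 := by
  simpa using h.add_mem_iff A hA 0 (by simpa using h.pos)

/-- Inside `U`, `Z` is the zero set of a continuous function, hence relatively closed. This lets `Z`
replace its closure near the base point. -/
theorem mem_closure_iff (h : IsLocalGraph Z U S κ δ) {A : E} (hA : A ∈ U) :
    A ∈ closure Z ↔ A ∈ Z := by
  refine ⟨fun hc => ?_, fun hc => subset_closure hc⟩
  rw [h.mem_iff hA]
  by_contra hne
  have h1 : ∀ᶠ B in 𝓝 A, κ B ≠ 0 := (h.smooth A hA).continuousAt.eventually_ne hne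
  obtain ⟨B, hB, hB1, hB2⟩ :=
    ((mem_closure_iff_frequently.1 hc).and_eventually
      (h1.and (h.isOpen.mem_nhds hA))).exists
  exact hB1 ((h.mem_iff hB2).1 hB)

theorem hasFDerivAt (h : IsLocalGraph Z U S κ δ) {A : E} (hA : A ∈ U) :
    HasFDerivAt κ (fderiv ℝ κ A) A :=
  ((h.smooth A hA).differentiableAt (by simp)).hasFDerivAt

/-- Translation by `S k` translates `κ` by `-k`. -/
theorem eventually_apply_add (h : IsLocalGraph Z U S κ δ) {A : E} (hA : A ∈ U)
    {k : EuclideanSpace ℝ (Fin 3)} (hAk : A + S k ∈ U) (hκ : κ A = k) (hk : ‖k‖ < δ) :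
    ∀ᶠ B in 𝓝 A, κ (B + S k) = κ B - k := by
  have hc := (h.smooth A hA).continuousAt
  have h1 : ∀ᶠ B in 𝓝 A, ‖κ B‖ < δ := hc.norm.eventually_lt_const (by simpa [hκ] using hk)
  have h2 : ∀ᶠ B in 𝓝 A, ‖κ B - k‖ < δ :=
    (hc.sub continuousAt_const).norm.eventually_lt_const (by simpa [hκ] using h.pos)
  have h3 : ∀ᶠ B in 𝓝 A, B + S k ∈ U :=
    (continuousAt_id.add continuousAt_const).eventually_mem (h.isOpen.mem_nhds hAk)
  filter_upwards [h1, h2, h3, h.isOpen.mem_nhds hA] with B hB1 hB2 hB3 hB4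
  -- Both sides express that `(B + S k) + S (κ B - k) = B + S (κ B)` lies in `Z`.
  rw [← h.add_mem_iff _ hB3 _ hB2, add_assoc, ← map_add, add_sub_cancel,
    h.add_mem_iff _ hB4 _ hB1]

/-- Adding `S (-k)` to `A + S k` leads back to `A ∈ Z`, so `κ (A + S k) = -k` for small `k`. In
particular `dκ` is onto. -/
theorem fderiv_apply_S (h : IsLocalGraph Z U S κ δ) {A : E} (hA : A ∈ U) (hZ : A ∈ Z)
    (k : EuclideanSpace ℝ (Fin 3)) : fderiv ℝ κ A (S k) = -k := by
  have hc : HasFDerivAt (fun k => A + S k) S 0 := S.hasFDerivAt.const_add A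
  have hd : HasFDerivAt (fun k => κ (A + S k)) (fderiv ℝ κ A ∘L S) 0 :=
    HasFDerivAt.comp (0 : EuclideanSpace ℝ (Fin 3)) (by simpa using h.hasFDerivAt hA) hc
  have he : (fun k => κ (A + S k)) =ᶠ[𝓝 0] fun k => -k := by
    have h1 : ∀ᶠ k in 𝓝 (0 : EuclideanSpace ℝ (Fin 3)), A + S k ∈ U :=
      hc.continuousAt.eventually_mem (by simpa using h.isOpen.mem_nhds hA)
    filter_upwards [h1, Metric.ball_mem_nhds _ h.pos] with k hk1 hk2
    rw [← h.add_mem_iff _ hk1 _ (by simpa using hk2)]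
    simpa using hZ
  have := (hd.congr_of_eventuallyEq he.symm).unique (hasFDerivAt_id (𝕜 := ℝ) 0).neg
  exact congr($this k)

/-- Along a curve in `Z`, `κ` vanishes, so its velocity is in the kernel. Conversely, the line `A +
t u` is pushed into `Z` along the range of `S`; the correction `S (κ (A + t u))` has zero velocity
when `dκ u = 0`. -/
theorem mem_tangentVectors_iff (h : IsLocalGraph Z U S κ δ) {A : E} (hA : A ∈ U) (hZ : A ∈ Z)
    (u : E) : u ∈ tangentVectors Z A ↔ fderiv ℝ κ A u = 0 := by
  constructor
  · rintro ⟨c, -, rfl, hcZ, hc⟩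
    have hd := (h.hasFDerivAt hA).comp_hasDerivAt 0 hc
    have he : (κ ∘ c) =ᶠ[𝓝 0] fun _ => 0 := by
      filter_upwards [hcZ, hc.continuousAt.eventually_mem (h.isOpen.mem_nhds hA)] with t h1 h2
      exact (h.mem_iff h2).1 h1
    exact (hd.congr_of_eventuallyEq he.symm).unique (hasDerivAt_const _ _)
  · intro hu
    have hline : HasDerivAt (fun t : ℝ => A + t • u) u 0 := by
      simpa using ((hasDerivAt_id (0 : ℝ)).smul_const u).const_add A
    have hO : ∀ᶠ t in 𝓝 (0 : ℝ), A + t • u ∈ U ∧ ‖κ (A + t • u)‖ < δ := by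
      have h1 : ∀ᶠ B in 𝓝 A, B ∈ U ∧ ‖κ B‖ < δ :=
        (show ∀ᶠ B in 𝓝 A, B ∈ U from h.isOpen.mem_nhds hA).and ((h.smooth A hA).continuousAt.norm.eventually_lt_const
          (by simpa [(h.mem_iff hA).1 hZ] using h.pos))
      exact hline.continuousAt.eventually (by simpa only [zero_smul, add_zero] using h1)
    obtain ⟨r, hr, hrO⟩ := Metric.eventually_nhds_iff.1 hO
    -- The curve must be smooth on all of ℝ. The sine keeps the parameter inside `(-r, r)` for all
    -- times, with unit speed at 0.
    set φ : ℝ → ℝ := fun t => r / 2 * Real.sin (t / (r / 2)) with hφ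
    have hφr : ∀ t, dist (φ t) 0 < r := by
      intro t
      have : |Real.sin (t / (r / 2))| ≤ 1 := Real.abs_sin_le_one _
      rw [dist_zero_right, hφ, Real.norm_eq_abs, abs_mul, abs_of_pos (by positivity)]
      nlinarith
    have hφs : ContDiff ℝ ∞ φ := by fun_prop
    have hφd : HasDerivAt φ 1 0 := by
      have := ((Real.hasDerivAt_sin (0 / (r / 2))).comp 0
        ((hasDerivAt_id (0 : ℝ)).div_const (r / 2))).const_mul (r / 2)
      have hr2 : r / 2 ≠ 0 := by positivity
      rw [zero_div, Real.cos_zero, one_mul, mul_one_div_cancel hr2] at this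
      exact this
    have hφ0 : φ 0 = 0 := by simp [hφ]
    refine ⟨fun t => A + φ t • u + S (κ (A + φ t • u)), ?_, ?_, ?_, ?_⟩
    · have h1 : ContDiff ℝ ∞ fun t => A + φ t • u := contDiff_const.add (hφs.smul contDiff_const)
      refine h1.add (S.contDiff.comp (contDiff_iff_contDiffAt.2 fun t => ?_))
      exact (h.smooth _ (hrO (hφr t)).1).comp t h1.contDiffAt
    · simp [hφ0, (h.mem_iff hA).1 hZ]
    · exact Filter.Eventually.of_forall fun t =>
        (h.add_mem_iff _ (hrO (hφr t)).1 _ (hrO (hφr t)).2).2 rfl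
    · have h1 : HasDerivAt (fun t : ℝ => A + φ t • u) u 0 := by
        simpa using (hφd.smul_const u).const_add A
      have h2 : HasDerivAt (fun t : ℝ => κ (A + φ t • u)) (fderiv ℝ κ A u) 0 :=
        HasFDerivAt.comp_hasDerivAt (0 : ℝ) (by simpa [hφ0] using h.hasFDerivAt hA) h1
      have h3 := h1.add (S.hasFDerivAt.comp_hasDerivAt (0 : ℝ) h2)
      rw [hu, map_zero, add_zero] at h3
      exact h3

variable {M : Type*} [TopologicalSpace M] [ChartedSpace (EuclideanSpace ℝ (Fin 3)) M]

/-- The tangent space is `ker dκ` and `dκ` is onto, so the tangent space and the range of `df` span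
`E` iff `dκ ∘ df` is onto. -/
theorem transverseAt_iff (h : IsLocalGraph Z U S κ δ) {f : M → E} {p : M} (hU : f p ∈ U)
    (hZ : f p ∈ Z) : TransverseAt f Z p ↔ Function.Surjective fun w : TangentSpace (𝓡 3) p =>
      fderiv ℝ κ (f p) (show E from mfderiv (𝓡 3) 𝓘(ℝ, E) f p w) := by
  constructor
  · intro ht y
    obtain ⟨u, hu, w, hw⟩ := ht (-S y)
    refine ⟨w, ?_⟩
    have h1 := congr(fderiv ℝ κ (f p) $hw)
    rw [map_add, (h.mem_tangentVectors_iff hU hZ u).1 hu, zero_add, map_neg,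
      h.fderiv_apply_S hU hZ, neg_neg] at h1
    exact h1.symm
  · intro hs v
    obtain ⟨w, hw⟩ := hs (fderiv ℝ κ (f p) v)
    refine ⟨v - (show E from mfderiv (𝓡 3) 𝓘(ℝ, E) f p w), ?_, w, ?_⟩
    · rw [h.mem_tangentVectors_iff hU hZ, map_sub, sub_eq_zero]
      exact hw.symm
    · exact (sub_add_cancel _ _).symm

variable [IsManifold (𝓡 3) ∞ M]

/-- Transversality in a chart. -/
theorem transverseAt_iff_chart (h : IsLocalGraph Z U S κ δ) {f : M → E} {p₀ : M}
    {y : EuclideanSpace ℝ (Fin 3)} (hy : y ∈ (extChartAt (𝓡 3) p₀).target)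
    (hf : MDifferentiableAt (𝓡 3) 𝓘(ℝ, E) f ((extChartAt (𝓡 3) p₀).symm y))
    (hU : f ((extChartAt (𝓡 3) p₀).symm y) ∈ U) (hZ : f ((extChartAt (𝓡 3) p₀).symm y) ∈ Z) :
    TransverseAt f Z ((extChartAt (𝓡 3) p₀).symm y) ↔
      (fderiv ℝ (fun z => κ (f ((extChartAt (𝓡 3) p₀).symm z))) y).IsInvertible := by
  have : IsManifold (𝓡 3) 1 M := IsManifold.of_le (n := ∞) (by norm_cast)
  have hinv := isInvertible_mfderivWithin_extChartAt_symm (I := 𝓡 3) hy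
  have hdiff := mdifferentiableWithinAt_extChartAt_symm (I := 𝓡 3) hy
  rw [ModelWithCorners.range_eq_univ, mdifferentiableWithinAt_univ] at hdiff
  rw [ModelWithCorners.range_eq_univ, mfderivWithin_univ] at hinv
  have h1 : MDifferentiableAt 𝓘(ℝ, E) 𝓘(ℝ, EuclideanSpace ℝ (Fin 3)) κ
      (f ((extChartAt (𝓡 3) p₀).symm y)) := (h.hasFDerivAt hU).differentiableAt.mdifferentiableAt
  have h2 := mfderiv_comp y (h1.comp _ hf) hdiff
  rw [mfderiv_comp _ h1 hf, mfderiv_eq_fderiv, mfderiv_eq_fderiv] at h2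
  have h3 : (fun z => κ (f ((extChartAt (𝓡 3) p₀).symm z))) =
    (κ ∘ f) ∘ (extChartAt (𝓡 3) p₀).symm := rfl
  rw [h.transverseAt_iff hU hZ, h3, isInvertible_iff_surjective, h2]
  obtain ⟨e, he⟩ := hinv
  rw [← he]
  exact ⟨fun hs => hs.comp e.surjective, fun hs => Function.Surjective.of_comp (g := e) hs⟩

end IsLocalGraph

/-! ### Stability and genericity of transverse points of a local graph. -/

theorem TransverseAt.congr {E : Type*} [NormedAddCommGroup E] [NormedSpace ℝ E]
    {M : Type*} [TopologicalSpace M] [ChartedSpace (EuclideanSpace ℝ (Fin 3)) M]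
    {f g : M → E} {Z : Set E} {p : M} (hf : TransverseAt f Z p) (hfg : g =ᶠ[𝓝 p] f) :
    TransverseAt g Z p := by
  intro v
  obtain ⟨u, hu, w, hw⟩ := hf v
  refine ⟨u, by rwa [hfg.self_of_nhds], w, ?_⟩
  rw [hw]
  congr 1
  have := hfg.mfderiv_eq (I := 𝓡 3) (I' := 𝓘(ℝ, E))
  exact (congr((show EuclideanSpace ℝ (Fin 3) →L[ℝ] E from $this) w)).symm

namespace IsLocalGraph

variable {E : Type*} [NormedAddCommGroup E] [NormedSpace ℝ E] {Z U : Set E}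
  {S : EuclideanSpace ℝ (Fin 3) →L[ℝ] E} {κ : E → EuclideanSpace ℝ (Fin 3)} {δ : ℝ}
  {M : Type*} [TopologicalSpace M]
  [ChartedSpace (EuclideanSpace ℝ (Fin 3)) M] [IsManifold (𝓡 3) ∞ M]

theorem stable_of_transverseAt (h : IsLocalGraph Z U S κ δ) {H : M → E} {p₀ : M}
    (hU : H p₀ ∈ U) (hZ : H p₀ ∈ Z) {W₀ : Set M} (hW₀ : IsOpen W₀) (hpW₀ : p₀ ∈ W₀)
    (hcomp : IsCompact (closure W₀)) (hisol : ∀ p ∈ closure W₀, H p ∈ closure Z → p = p₀)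
    (htrans : TransverseAt H Z p₀) {Ω : Set (M × ℝ)} {Ht : M × ℝ → E} (hΩ : IsOpen Ω)
    (hWΩ : ∀ p ∈ closure W₀, (p, (0 : ℝ)) ∈ Ω)
    (hHt : ContMDiffOn ((𝓡 3).prod 𝓘(ℝ, ℝ)) 𝓘(ℝ, E) ∞ Ht Ω)
    (hH0 : ∀ p : M, (p, (0 : ℝ)) ∈ Ω → Ht (p, 0) = H p) :
    ∃ ε : ℝ, 0 < ε ∧ W₀ ×ˢ Ioo (-ε) ε ⊆ Ω ∧
      ∃ γ : ℝ → M, ContMDiffOn 𝓘(ℝ, ℝ) (𝓡 3) ∞ γ (Ioo (-ε) ε) ∧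
        ∀ t ∈ Ioo (-ε) ε, {p ∈ W₀ | Ht (p, t) ∈ closure Z} = {γ t} ∧
          Ht (γ t, t) ∈ Z ∧ TransverseAt (fun q => Ht (q, t)) Z (γ t) := by
  set φ := extChartAt (𝓡 3) p₀ with hφ
  set y₀ := φ p₀ with hy₀
  have hp₀s : p₀ ∈ φ.source := mem_extChartAt_source p₀
  have hy₀t : y₀ ∈ φ.target := φ.map_source hp₀s
  have hφt : IsOpen φ.target := isOpen_extChartAt_target p₀
  have hsymm : φ.symm y₀ = p₀ := φ.left_inv hp₀s
  have hp₀Ω := hWΩ p₀ (subset_closure hpW₀)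
  have hHtAt : ∀ v ∈ Ω, ContMDiffAt ((𝓡 3).prod 𝓘(ℝ, ℝ)) 𝓘(ℝ, E) ∞ Ht v :=
    fun v hv => hHt.contMDiffAt (hΩ.mem_nhds hv)
  -- Time is the first factor, so that the implicit function theorem solves for the point as a
  -- function of time.
  set ι : ℝ × EuclideanSpace ℝ (Fin 3) → M × ℝ := fun v => (φ.symm v.2, v.1) with hι
  have hιs : ∀ v, v.2 ∈ φ.target →
      ContMDiffAt 𝓘(ℝ, ℝ × EuclideanSpace ℝ (Fin 3)) ((𝓡 3).prod 𝓘(ℝ, ℝ)) ∞ ι v := by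
    intro v hv
    have h1 : ContMDiffAt 𝓘(ℝ, EuclideanSpace ℝ (Fin 3)) (𝓡 3) ∞ φ.symm v.2 :=
      (contMDiffOn_extChartAt_symm p₀).contMDiffAt (hφt.mem_nhds hv)
    exact (ContMDiffAt.comp v h1 contDiff_snd.contMDiff.contMDiffAt).prodMk
      contDiff_fst.contMDiff.contMDiffAt
  set f : ℝ × EuclideanSpace ℝ (Fin 3) → EuclideanSpace ℝ (Fin 3) := fun v => κ (Ht (ι v)) with hf
  set u : ℝ × EuclideanSpace ℝ (Fin 3) := (0, y₀) with hu
  have hιu : ι u = (p₀, 0) := by simp [hι, hu, hsymm]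
  have hιc : ContinuousAt ι u := (hιs u hy₀t).continuousAt
  have hHtu : Ht (ι u) = H p₀ := by rw [hιu, hH0 _ hp₀Ω]
  have hg1 : ∀ᶠ v in 𝓝 u, v.2 ∈ φ.target :=
    continuousAt_snd.eventually_mem (hφt.mem_nhds hy₀t)
  have hg2 : ∀ᶠ v in 𝓝 u, ι v ∈ Ω := hιc.eventually_mem (hΩ.mem_nhds (by rwa [hιu]))
  have hg3 : ∀ᶠ v in 𝓝 u, Ht (ι v) ∈ U := by
    refine ContinuousAt.eventually_mem (f := fun v => Ht (ι v)) ?_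
      (h.isOpen.mem_nhds (by rwa [hHtu]))
    exact ContinuousAt.comp (hHtAt _ (by rwa [hιu])).continuousAt hιc
  have hg4 : ∀ᶠ v in 𝓝 u, (ι v).1 ∈ W₀ :=
    (continuousAt_fst.comp hιc).eventually_mem (hW₀.mem_nhds (by simpa [hιu] using hpW₀))
  have hfsm : ∀ v, v.2 ∈ φ.target → ι v ∈ Ω → Ht (ι v) ∈ U → ContDiffAt ℝ ∞ f v := by
    intro v h1 h2 h3
    have h4 : ContDiffAt ℝ ∞ (fun v => Ht (ι v)) v :=
      contMDiffAt_iff_contDiffAt.1 (ContMDiffAt.comp v (hHtAt _ h2) (hιs v h1))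
    exact (h.smooth _ h3).comp v h4
  have hfev : ∀ᶠ v in 𝓝 u, ContDiffAt ℝ ∞ f v := by
    filter_upwards [hg1, hg2, hg3] with v h1 h2 h3 using hfsm v h1 h2 h3
  have htr : ∀ v, v.2 ∈ φ.target → ι v ∈ Ω → Ht (ι v) ∈ U → Ht (ι v) ∈ Z →
      (TransverseAt (fun q => Ht (q, v.1)) Z (φ.symm v.2) ↔
        (fderiv ℝ f v ∘L .inr ℝ ℝ (EuclideanSpace ℝ (Fin 3))).IsInvertible) := by
    intro v h1 h2 h3 h4
    have h5 : ContMDiffAt (𝓡 3) 𝓘(ℝ, E) ∞ (fun q => Ht (q, v.1)) (φ.symm v.2) :=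
      ContMDiffAt.comp (φ.symm v.2) (hHtAt _ h2) (contMDiffAt_id.prodMk contMDiffAt_const)
    rw [h.transverseAt_iff_chart h1 (h5.mdifferentiableAt (by simp)) h3 h4]
    have h6 : HasFDerivAt (fun z => f (v.1, z))
        (fderiv ℝ f v ∘L .inr ℝ ℝ (EuclideanSpace ℝ (Fin 3))) v.2 :=
      HasFDerivAt.comp (g := f) (f := fun z => (v.1, z)) v.2
        ((hfsm v h1 h2 h3).differentiableAt (by simp)).hasFDerivAt
        (hasFDerivAt_prodMk_right v.1 v.2)
    rw [← h6.fderiv]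
  have hfu : f u = 0 := by
    simp only [hf, hHtu]
    exact (h.mem_iff hU).1 hZ
  have hinv : (fderiv ℝ f u ∘L .inr ℝ ℝ (EuclideanSpace ℝ (Fin 3))).IsInvertible := by
    refine (htr u hy₀t (by rwa [hιu]) (by rwa [hHtu]) (by rwa [hHtu])).1 ?_
    have h1 : (fun q => Ht (q, u.1)) =ᶠ[𝓝 (φ.symm u.2)] H := by
      have : ContinuousAt (fun q : M => (q, (0 : ℝ))) (φ.symm u.2) := by fun_prop
      filter_upwards [this.eventually_mem (hΩ.mem_nhds (by simpa [hu, hsymm] using hp₀Ω))] with q hq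
      exact hH0 q hq
    refine TransverseAt.congr ?_ h1
    simpa [hu, hsymm] using htrans
  obtain ⟨g, hgu, hgs, hgiff⟩ := exists_smooth_implicitFunction hfev hinv
  have hall := hg1.and (hg2.and (hg3.and (hg4.and (hgiff.and
    (eventually_isInvertible_fderiv_inr hfev.self_of_nhds hinv)))))
  obtain ⟨T, N, hT, hT0, hN, hNy, hTN⟩ := mem_nhds_prod_iff'.1 hall
  have hopen : IsOpen (φ.source ∩ φ ⁻¹' N) :=
    (continuousOn_extChartAt p₀).isOpen_inter_preimage (isOpen_extChartAt_source p₀) hN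
  -- Away from the chart neighbourhood `N`, `cl W₀` is compact and `H` avoids the closed set
  -- `closure Z`; this persists for small `t`.
  have hout : ∀ᶠ t in 𝓝 (0 : ℝ), ∀ p ∈ closure W₀ \ (φ.source ∩ φ ⁻¹' N),
      Ht (p, t) ∉ closure Z := by
    refine (hcomp.diff hopen).eventually_forall_of_forall_eventually
      (P := fun t p => Ht (p, t) ∉ closure Z) fun p hp => ?_
    have hc : ContinuousAt (fun z : ℝ × M => Ht (z.2, z.1)) (0, p) :=
      ContinuousAt.comp (f := fun z : ℝ × M => (z.2, z.1)) (hHtAt _ (hWΩ p hp.1)).continuousAt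
        (by fun_prop)
    refine hc.eventually_mem (isClosed_closure.isOpen_compl.mem_nhds ?_)
    intro hmem
    rw [hH0 p (hWΩ p hp.1)] at hmem
    obtain rfl := hisol p hp.1 hmem
    exact hp.2 ⟨hp₀s, hNy⟩
  have hinΩ : ∀ᶠ t in 𝓝 (0 : ℝ), ∀ p ∈ closure W₀, (p, t) ∈ Ω := by
    refine hcomp.eventually_forall_of_forall_eventually
      (P := fun t p => (p, t) ∈ Ω) fun p hp => ?_
    have hc : ContinuousAt (fun z : ℝ × M => (z.2, z.1)) (0, p) := by fun_prop
    exact hc.eventually_mem (hΩ.mem_nhds (hWΩ p hp))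
  have hgN : ∀ᶠ t in 𝓝 (0 : ℝ), g t ∈ N :=
    hgs.self_of_nhds.continuousAt.eventually_mem (hN.mem_nhds (by rw [hgu]; exact hNy))
  obtain ⟨ε, hε, hball⟩ := Metric.eventually_nhds_iff.1
    ((show ∀ᶠ t in 𝓝 (0 : ℝ), t ∈ T from hT.mem_nhds hT0).and (hgs.and (hout.and (hinΩ.and hgN))))
  have hdist : ∀ t ∈ Ioo (-ε) ε, dist t 0 < ε := by
    intro t ht
    rw [Real.dist_0_eq_abs]
    exact abs_lt.2 ht
  refine ⟨ε, hε, ?_, fun t => φ.symm (g t), ?_, ?_⟩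
  · rintro ⟨p, t⟩ ⟨hp, ht⟩
    exact (hball (hdist t ht)).2.2.2.1 p (subset_closure hp)
  · intro t ht
    obtain ⟨h1, h2, -, -, h5⟩ := hball (hdist t ht)
    have h6 : g t ∈ φ.target := (hTN (show (t, g t) ∈ T ×ˢ N from ⟨h1, h5⟩)).1
    have h7 : ContMDiffAt 𝓘(ℝ, EuclideanSpace ℝ (Fin 3)) (𝓡 3) ∞ φ.symm (g t) :=
      (contMDiffOn_extChartAt_symm p₀).contMDiffAt (hφt.mem_nhds h6)
    exact (ContMDiffAt.comp t h7 h2.contMDiffAt).contMDiffWithinAt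
  · intro t ht
    obtain ⟨h1, h2, h3, h4, h5⟩ := hball (hdist t ht)
    obtain ⟨a1, a2, a3, a4, a5, a6⟩ := hTN (show (t, g t) ∈ T ×ˢ N from ⟨h1, h5⟩)
    have hzero : Ht (φ.symm (g t), t) ∈ Z := by
      rw [h.mem_iff a3]
      exact (a5.2 rfl).trans hfu
    refine ⟨?_, hzero, (htr (t, g t) a1 a2 a3 hzero).2 a6⟩
    ext p
    constructor
    · rintro ⟨hp, hpZ⟩
      by_cases hpN : p ∈ φ.source ∩ φ ⁻¹' N
      · obtain ⟨b1, b2, b3, b4, b5, b6⟩ := hTN (show (t, φ p) ∈ T ×ˢ N from ⟨h1, hpN.2⟩)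
        have hpp : ι (t, φ p) = (p, t) := by simp [hι, φ.left_inv hpN.1]
        rw [hpp] at b3
        have h7 : f (t, φ p) = f u := by
          rw [hfu]
          simp only [hf, hpp]
          exact (h.mem_iff b3).1 ((h.mem_closure_iff b3).1 hpZ)
        have h8 : g t = φ p := b5.1 h7
        simp [h8, φ.left_inv hpN.1]
      · exact absurd hpZ (h3 p ⟨subset_closure hp, hpN⟩)
    · rintro rfl
      exact ⟨a4, subset_closure hzero⟩

-- Translating by `S k` turns the zeros of `κ ∘ H` near `p₀` into its `k`-level set, so `k` should
-- be a small regular value; compactness handles the rest of `cl W₀`.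
open MeasureTheory in
theorem exists_translate_transverseAt (h : IsLocalGraph Z U S κ δ) {H : M → E}
    (hH : ContMDiff (𝓡 3) 𝓘(ℝ, E) ∞ H) {p₀ : M} (hU : H p₀ ∈ U) {W₀ : Set M}
    (hcomp : IsCompact (closure W₀)) (hisol : ∀ p ∈ closure W₀, H p ∈ closure Z → p = p₀)
    {ε : ℝ} (hε : 0 < ε) :
    ∃ K : E, ‖K‖ < ε ∧ ∀ p ∈ W₀, H p + K ∈ closure Z →
      H p + K ∈ Z ∧ TransverseAt (fun q => H q + K) Z p := by
  set φ := extChartAt (𝓡 3) p₀ with hφ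
  have hφt : IsOpen φ.target := isOpen_extChartAt_target p₀
  have hp₀s : p₀ ∈ φ.source := mem_extChartAt_source p₀
  have hsum : Continuous fun z : EuclideanSpace ℝ (Fin 3) × M => H z.2 + S z.1 :=
    (hH.continuous.comp continuous_snd).add (S.continuous.comp continuous_fst)
  have hg1 : ∀ᶠ z in 𝓝 ((0 : EuclideanSpace ℝ (Fin 3)), p₀), H z.2 + S z.1 ∈ U :=
    hsum.continuousAt.eventually_mem (h.isOpen.mem_nhds (by simpa using hU))
  have hg2 : ∀ᶠ z in 𝓝 ((0 : EuclideanSpace ℝ (Fin 3)), p₀), z.2 ∈ φ.source :=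
    continuousAt_snd.eventually_mem ((isOpen_extChartAt_source p₀).mem_nhds hp₀s)
  have hg3 : ∀ᶠ z in 𝓝 ((0 : EuclideanSpace ℝ (Fin 3)), p₀), H z.2 ∈ U :=
    (hH.continuous.comp continuous_snd).continuousAt.eventually_mem (h.isOpen.mem_nhds hU)
  obtain ⟨B, V, hB, hB0, hV, hVp, hBV⟩ := mem_nhds_prod_iff'.1 (hg1.and (hg2.and hg3))
  have hout : ∀ᶠ k in 𝓝 (0 : EuclideanSpace ℝ (Fin 3)), ∀ p ∈ closure W₀ \ V,
      H p + S k ∉ closure Z := by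
    refine (hcomp.diff hV).eventually_forall_of_forall_eventually
      (P := fun k p => H p + S k ∉ closure Z) fun p hp => ?_
    refine hsum.continuousAt.eventually_mem (isClosed_closure.isOpen_compl.mem_nhds ?_)
    intro hmem
    rw [map_zero, add_zero] at hmem
    obtain rfl := hisol p hp.1 hmem
    exact hp.2 hVp
  have hsmall : ∀ᶠ k in 𝓝 (0 : EuclideanSpace ℝ (Fin 3)), ‖S k‖ < ε :=
    S.continuous.norm.continuousAt.eventually_lt_const (by simpa using hε)
  have hδ : ∀ᶠ k in 𝓝 (0 : EuclideanSpace ℝ (Fin 3)), ‖k‖ < δ :=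
    continuous_norm.continuousAt.eventually_lt_const (by simpa using h.pos)
  set ψ : EuclideanSpace ℝ (Fin 3) → EuclideanSpace ℝ (Fin 3) := fun y => κ (H (φ.symm y)) with hψ
  have hHs : ∀ y ∈ φ.target, ContDiffAt ℝ ∞ (fun y => H (φ.symm y)) y := fun y hy =>
    contMDiffAt_iff_contDiffAt.1 (ContMDiffAt.comp y hH.contMDiffAt
      ((contMDiffOn_extChartAt_symm p₀).contMDiffAt (hφt.mem_nhds hy)))
  have hψs : ∀ y ∈ φ.target, H (φ.symm y) ∈ U → HasFDerivAt ψ (fderiv ℝ ψ y) y :=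
    fun y hy hyU => ((((h.smooth _ hyU).comp y (hHs y hy)).differentiableAt (by simp))).hasFDerivAt
  set s : Set (EuclideanSpace ℝ (Fin 3)) :=
    {y | y ∈ φ.target ∧ H (φ.symm y) ∈ U ∧ (fderiv ℝ ψ y).det = 0} with hs
  -- Sard's theorem in equal dimensions: critical values form a null set, so regular values
  -- accumulate at 0.
  have hsard : volume (ψ '' s) = 0 :=
    addHaar_image_eq_zero_of_det_fderivWithin_eq_zero volume
      (fun y hy => (hψs y hy.1 hy.2.1).hasFDerivWithinAt) (fun y hy => hy.2.2)
  have hdense : Dense (ψ '' s)ᶜ := Measure.dense_of_ae (measure_eq_zero_iff_ae_notMem.1 hsard)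
  obtain ⟨k, hk, hkB, hkout, hkε, hkδ⟩ := (mem_closure_iff_frequently.1 (hdense 0)).and_eventually
    ((show ∀ᶠ k in 𝓝 (0 : EuclideanSpace ℝ (Fin 3)), k ∈ B from hB.mem_nhds hB0).and
      (hout.and (hsmall.and hδ))) |>.exists
  refine ⟨S k, hkε, fun p hp hpZ => ?_⟩
  have hpV : p ∈ V := by
    by_contra hpV
    exact hkout p ⟨subset_closure hp, hpV⟩ hpZ
  obtain ⟨h1, h2, h3⟩ := hBV (show (k, p) ∈ B ×ˢ V from ⟨hkB, hpV⟩)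
  dsimp only at h1 h2 h3
  have hZ := (h.mem_closure_iff h1).1 hpZ
  refine ⟨hZ, ?_⟩
  have hκ : κ (H p) = k := (h.add_mem_iff _ h3 _ hkδ).1 hZ
  obtain ⟨y, hy, rfl⟩ : ∃ y ∈ φ.target, φ.symm y = p := ⟨φ p, φ.map_source h2, φ.left_inv h2⟩
  have hdet : (fderiv ℝ ψ y).det ≠ 0 := fun h0 => hk ⟨y, ⟨hy, h3, h0⟩, hκ⟩
  have hmd : MDifferentiableAt (𝓡 3) 𝓘(ℝ, E) (fun q => H q + S k) (φ.symm y) :=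
    (hH.add contMDiff_const).mdifferentiable (by simp) _
  rw [h.transverseAt_iff_chart hy hmd h1 hZ]
  have hev : (fun z => κ (H (φ.symm z) + S k)) =ᶠ[𝓝 y] fun z => ψ z - k :=
    (hHs y hy).continuousAt.eventually (h.eventually_apply_add h3 h1 hκ hkδ)
  rw [hev.fderiv_eq, fderiv_sub_const, isInvertible_iff_surjective]
  have := LinearMap.isUnit_iff_isUnit_det (fderiv ℝ ψ y : _ →ₗ[ℝ] EuclideanSpace ℝ (Fin 3)) |>.2
    (isUnit_iff_ne_zero.2 hdet)
  exact ((Module.End.isUnit_iff _).1 this).2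

end IsLocalGraph

/-! ### Spectral characterisation of twofold degeneracy and the Grushin reduction. -/

section Spectral

open Matrix
open scoped ComplexOrder

variable {n : ℕ}

theorem ordEig_monotone (A : Herm n) : Monotone (ordEig A) := fun i j hij =>
  A.isHermitian.eigenvalues₀_antitone (by simpa [Fin.le_def] using by omega)

/-- Spectral theorem with eigenvalues in increasing order. -/
theorem Herm.exists_diagonalization (A : Herm n) :
    ∃ U : Matrix (Fin n) (Fin n) ℂ, Uᴴ * U = 1 ∧ U * Uᴴ = 1 ∧
      A.toMatrix = U * Matrix.diagonal (fun i => (ordEig A i : ℂ)) * Uᴴ := by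
  -- Reverses the decreasing order of `eigenvalues₀` and undoes the reindexing in `eigenvalues`.
  set e : Fin n ≃ Fin n := Fin.revPerm.trans
    ((finCongr (Fintype.card_fin n).symm).trans (Fintype.equivOfCardEq (Fintype.card_fin _))) with he
  have hev : (fun i => (ordEig A i : ℂ)) = (RCLike.ofReal ∘ A.isHermitian.eigenvalues) ∘ e := by
    ext i
    simp [ordEig, IsHermitian.eigenvalues, he]
  set W : Matrix (Fin n) (Fin n) ℂ := ↑(A.isHermitian.eigenvectorUnitary) with hW
  have hW1 : Wᴴ * W = 1 := Unitary.coe_star_mul_self _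
  have hW2 : W * Wᴴ = 1 := Unitary.coe_mul_star_self _
  have h3 := A.isHermitian.spectral_theorem
  rw [Unitary.conjStarAlgAut_apply] at h3
  refine ⟨W.submatrix id e, ?_, ?_, ?_⟩
  · rw [conjTranspose_submatrix, ← submatrix_mul _ _ _ _ _ Function.bijective_id, hW1,
      submatrix_one_equiv]
  · rw [conjTranspose_submatrix, submatrix_mul_equiv, hW2, submatrix_id_id]
  · rw [hev, ← submatrix_diagonal_equiv, conjTranspose_submatrix, submatrix_mul_equiv,
      submatrix_mul_equiv, submatrix_id_id]
    exact h3

/-- `A - λ` as a matrix. -/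
def Herm.shift (A : Herm n) (l : ℝ) : Matrix (Fin n) (Fin n) ℂ := A.toMatrix - (l : ℂ) • 1

theorem Herm.isHermitian_shift (A : Herm n) (l : ℝ) : (A.shift l).IsHermitian := by
  refine A.isHermitian.sub ?_
  simp [IsHermitian, conjTranspose_smul]

theorem Herm.shift_eq {A : Herm n} {U : Matrix (Fin n) (Fin n) ℂ} (hU : U * Uᴴ = 1)
    (hA : A.toMatrix = U * Matrix.diagonal (fun i => (ordEig A i : ℂ)) * Uᴴ) (l : ℝ) :
    A.shift l = U * Matrix.diagonal (fun i => ((ordEig A i - l : ℝ) : ℂ)) * Uᴴ := by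
  have : Matrix.diagonal (fun i => ((ordEig A i - l : ℝ) : ℂ)) =
      Matrix.diagonal (fun i => (ordEig A i : ℂ)) - (l : ℂ) • 1 := by
    ext i j
    by_cases h : i = j <;> simp [one_apply, h]
  rw [this, Matrix.mul_sub, Matrix.sub_mul, ← hA, mul_smul_comm, smul_mul_assoc, Matrix.mul_one, hU, Herm.shift]

theorem Herm.posSemidef_shift (A : Herm n) {l : ℝ} (hl : ∀ i, l ≤ ordEig A i) :
    (A.shift l).PosSemidef := by
  obtain ⟨U, -, hU, hA⟩ := A.exists_diagonalization
  rw [Herm.shift_eq hU hA]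
  exact (PosSemidef.diagonal fun i => by simpa using hl i).mul_mul_conjTranspose_same U

theorem exists_ne_zero_mulVec_eq_zero {k m : ℕ} (hkm : k < m) (N : Matrix (Fin k) (Fin m) ℂ) :
    ∃ c : Fin m → ℂ, c ≠ 0 ∧ N *ᵥ c = 0 := by
  have := LinearMap.ker_ne_bot_of_finrank_lt (f := N.mulVecLin) (by simpa using hkm)
  obtain ⟨c, hc, hc0⟩ := Submodule.exists_mem_ne_zero_of_ne_bot this
  exact ⟨c, hc0, by simpa using hc⟩

/-- If `A - λ` becomes positive definite after adding a rank two matrix, then at most two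
eigenvalues of `A` are `≤ λ`. -/
theorem exists_lt_ordEig_of_posDef {A : Herm n} {l : ℝ} {V : Matrix (Fin n) (Fin 2) ℂ}
    (hP : (A.shift l + V * Vᴴ).PosDef) {idx : Fin 3 → Fin n} (hidx : Function.Injective idx) :
    ∃ m, l < ordEig A (idx m) := by
  by_contra! hle
  obtain ⟨U, hU1, hU, hA⟩ := A.exists_diagonalization
  set B := U.submatrix id idx with hB
  have hB1 : Bᴴ * U = (1 : Matrix (Fin n) (Fin n) ℂ).submatrix idx id := by
    rw [hB, conjTranspose_submatrix, ← hU1, submatrix_mul _ _ _ _ _ Function.bijective_id,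
      submatrix_id_id]
  have hB2 : Uᴴ * B = (1 : Matrix (Fin n) (Fin n) ℂ).submatrix id idx := by
    rw [← conjTranspose_inj, conjTranspose_mul, conjTranspose_conjTranspose, hB1,
      conjTranspose_submatrix, conjTranspose_one]
  have hinj : Function.Injective B.mulVec := by
    intro x y hxy
    have h1 : (Uᴴ * B) *ᵥ x = (Uᴴ * B) *ᵥ y := by
      rw [← mulVec_mulVec, ← mulVec_mulVec, hxy]
    rw [hB2] at h1
    ext m
    have := congrFun h1 (idx m)
    simpa [mulVec, dotProduct, submatrix_apply, one_apply, hidx.eq_iff] using this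
  have hdiag : Bᴴ * A.shift l * B = Matrix.diagonal (fun m => ((ordEig A (idx m) - l : ℝ) : ℂ)) := by
    rw [Herm.shift_eq hU hA, ← Matrix.mul_assoc, ← Matrix.mul_assoc, hB1, Matrix.mul_assoc, hB2]
    ext i j
    by_cases h : i = j <;> simp [mul_apply, one_apply, diagonal_apply, hidx.eq_iff, h]
  -- Two equations in three unknowns: on the span of the three eigenvectors some nonzero vector does
  -- not see `V Vᴴ`, and there the form is at most 0.
  obtain ⟨c, hc0, hc⟩ := exists_ne_zero_mulVec_eq_zero (by norm_num) (Vᴴ * B)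
  have hpos := (hP.conjTranspose_mul_mul_same hinj).dotProduct_mulVec_pos hc0
  rw [Matrix.mul_add, Matrix.add_mul, hdiag, add_mulVec, show Bᴴ * (V * Vᴴ) * B = Bᴴ * V * (Vᴴ * B) by
    simp only [Matrix.mul_assoc], ← mulVec_mulVec, hc, mulVec_zero, add_zero] at hpos
  have hneg : (star c ⬝ᵥ (Matrix.diagonal fun m => ((ordEig A (idx m) - l : ℝ) : ℂ)) *ᵥ c) =
      ((∑ m, (ordEig A (idx m) - l) * Complex.normSq (c m) : ℝ) : ℂ) := by
    simp only [dotProduct, mulVec_diagonal, Pi.star_apply, Complex.ofReal_sum]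
    refine Finset.sum_congr rfl fun m _ => ?_
    rw [Complex.ofReal_mul, ← Complex.mul_conj, Complex.star_def]
    ring
  rw [hneg, Complex.zero_lt_real] at hpos
  refine absurd hpos (not_lt.2 (Finset.sum_nonpos fun m _ => ?_))
  exact mul_nonpos_of_nonpos_of_nonneg (by linarith [hle m]) (Complex.normSq_nonneg _)

/-- Two independent eigenvectors for `λ` force two of the listed eigenvalues to be `λ`. -/
theorem exists_ordEig_eq {A : Herm n} {l : ℝ} {W : Matrix (Fin n) (Fin 2) ℂ}
    (hW : Function.Injective W.mulVec) (hAW : A.shift l * W = 0) :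
    ∃ i j, i ≠ j ∧ ordEig A i = l ∧ ordEig A j = l := by
  obtain ⟨U, hU1, hU, hA⟩ := A.exists_diagonalization
  set X := Uᴴ * W with hX
  have hUX : U * X = W := by rw [hX, ← Matrix.mul_assoc, hU, Matrix.one_mul]
  have hXinj : ∀ c, X *ᵥ c = 0 → c = 0 := by
    intro c hc
    apply hW
    rw [mulVec_zero, ← hUX, ← mulVec_mulVec, hc, mulVec_zero]
  have hdX : Matrix.diagonal (fun i => ((ordEig A i - l : ℝ) : ℂ)) * X = 0 := by
    have : Uᴴ * (A.shift l * W) = 0 := by rw [hAW, Matrix.mul_zero]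
    rwa [Herm.shift_eq hU hA, ← Matrix.mul_assoc, ← Matrix.mul_assoc, ← Matrix.mul_assoc, hU1, Matrix.one_mul,
      Matrix.mul_assoc] at this
  have hrow : ∀ i, ordEig A i ≠ l → ∀ c, (X *ᵥ c) i = 0 := by
    intro i hi c
    have h1 := congrFun (congrArg (· *ᵥ c) hdX) i
    simp only [← mulVec_mulVec, mulVec_diagonal, zero_mulVec, Pi.zero_apply] at h1
    refine (mul_eq_zero.1 h1).resolve_left ?_
    exact_mod_cast sub_ne_zero.2 hi
  -- Only rows of `X` with eigenvalue `l` can be nonzero. With at most one such row, `X` would kill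
  -- a nonzero vector.
  by_contra! hno
  obtain ⟨i₀, hi₀⟩ : ∃ i₀ : Fin n, ordEig A i₀ = l := by
    by_contra! hne
    have := hXinj ![1, 0] (funext fun i => hrow i (hne i) _)
    simpa using congrFun this 0
  obtain ⟨c, hc0, hc⟩ := exists_ne_zero_mulVec_eq_zero (k := 1) (m := 2) (by norm_num)
    (X.submatrix (fun _ => i₀) id)
  refine hc0 (hXinj c (funext fun i => ?_))
  by_cases hi : i = i₀
  · exact hi ▸ congrFun hc 0
  · exact hrow i (hno i₀ i (Ne.symm hi) hi₀) c

/-- The kernel gives two eigenvalues equal to `l`; positivity after a rank two correction leaves no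
third one `≤ l`. These two are therefore the lowest, and all others are larger. -/
theorem mem_groundDeg_of_posDef {A : Herm n} {l : ℝ} {V W : Matrix (Fin n) (Fin 2) ℂ}
    (hP : (A.shift l + V * Vᴴ).PosDef) (hW : Function.Injective W.mulVec)
    (hAW : A.shift l * W = 0) : A ∈ groundDeg n 2 := by
  obtain ⟨i, j, hij, hi, hj⟩ := exists_ordEig_eq hW hAW
  have hgt : ∀ m, m ≠ i → m ≠ j → l < ordEig A m := by
    intro m hmi hmj
    obtain ⟨q, hq⟩ := exists_lt_ordEig_of_posDef hP (idx := ![i, j, m]) (by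
      intro a b hab
      fin_cases a <;> fin_cases b <;> simp_all)
    fin_cases q <;> simp_all
  have hlow : ∀ m : Fin n, m.val < 2 → m = i ∨ m = j := by
    intro m hm
    by_contra! hne
    have h1 := hgt m hne.1 hne.2
    have h2 : m < i ∨ m < j := by
      simp only [Fin.lt_def]
      have := Fin.val_ne_of_ne hne.1
      have := Fin.val_ne_of_ne hne.2
      have := Fin.val_ne_of_ne hij
      omega
    rcases h2 with h2 | h2
    · linarith [ordEig_monotone A h2.le]
    · linarith [ordEig_monotone A h2.le]
  have hn : 2 ≤ n := by
    have := Fin.val_ne_of_ne hij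
    omega
  have hlow' : ∀ m : Fin n, m.val < 2 → ordEig A m = l := by
    intro m hm
    rcases hlow m hm with rfl | rfl <;> assumption
  refine ⟨hn, fun a b ha hb => by rw [hlow' a ha, hlow' b hb], fun a b ha hb => ?_⟩
  rw [hlow' a ha]
  have h0 := hlow ⟨0, by omega⟩ (by norm_num)
  have h1 := hlow ⟨1, by omega⟩ (by norm_num)
  refine hgt b ?_ ?_
  · rintro rfl
    simp only [Fin.ext_iff] at *
    omega
  · rintro rfl
    simp only [Fin.ext_iff] at *
    omega

/-- The ground space of a twofold degenerate matrix. -/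
theorem exists_groundSpace {A : Herm n} (hA : A ∈ groundDeg n 2) :
    ∃ (l : ℝ) (V : Matrix (Fin n) (Fin 2) ℂ), (∀ i, l ≤ ordEig A i) ∧ Vᴴ * V = 1 ∧
      A.shift l * V = 0 ∧ (A.shift l + V * Vᴴ).PosDef := by
  obtain ⟨hn, heq, hlt⟩ := hA
  obtain ⟨U, hU1, hU, hd⟩ := A.exists_diagonalization
  set i₀ : Fin n := ⟨0, by omega⟩ with hi₀
  set l := ordEig A i₀ with hl
  set ι : Fin 2 → Fin n := Fin.castLE hn with hι
  set N : Matrix (Fin n) (Fin 2) ℂ := (1 : Matrix (Fin n) (Fin n) ℂ).submatrix id ι with hN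
  have hlow : ∀ i : Fin n, i.val < 2 → ordEig A i = l := fun i hi => heq i i₀ hi (by simp [hi₀])
  have hNN : Nᴴ * N = 1 := by
    rw [hN, conjTranspose_submatrix, ← submatrix_mul _ _ _ _ _ Function.bijective_id,
      conjTranspose_one, Matrix.one_mul]
    exact submatrix_one _ (Fin.castLE_injective hn)
  have hNN' : N * Nᴴ = Matrix.diagonal fun i : Fin n => if i.val < 2 then (1 : ℂ) else 0 := by
    ext i j
    simp only [hN, mul_apply, Fin.sum_univ_two, conjTranspose_apply, submatrix_apply, id, one_apply,
      diagonal_apply, hι, Fin.ext_iff, Fin.val_castLE]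
    simp only [Fin.val_zero, Fin.val_one]
    split_ifs <;> first | omega | simp
  have hdN : Matrix.diagonal (fun i => ((ordEig A i - l : ℝ) : ℂ)) * N = 0 := by
    ext i j
    rw [diagonal_mul, hN, submatrix_apply, id, one_apply]
    split_ifs with h
    · rw [hlow i (by rw [h]; exact j.isLt)]
      simp
    · simp
  refine ⟨l, U * N, fun i => ordEig_monotone A (by simp [hi₀, Fin.le_def]), ?_, ?_, ?_⟩
  · rw [conjTranspose_mul, Matrix.mul_assoc, ← Matrix.mul_assoc Uᴴ, hU1, Matrix.one_mul, hNN]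
  · rw [Herm.shift_eq hU hd, Matrix.mul_assoc, ← Matrix.mul_assoc Uᴴ, hU1, Matrix.one_mul, Matrix.mul_assoc, hdN, Matrix.mul_zero]
  -- Adding the ground-space projection lifts the two zero eigenvalues of `A - l` to 1 and leaves
  -- the positive ones unchanged.
  · have h1 : A.shift l + U * N * (U * N)ᴴ =
        U * Matrix.diagonal (fun i => (((ordEig A i - l) + if i.val < 2 then 1 else 0 : ℝ) : ℂ)) * Uᴴ := by
      have h2 : Matrix.diagonal (fun i => (((ordEig A i - l) + if i.val < 2 then 1 else 0 : ℝ) : ℂ)) =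
          Matrix.diagonal (fun i => ((ordEig A i - l : ℝ) : ℂ)) + N * Nᴴ := by
        rw [hNN', diagonal_add]
        congr 1
        ext i
        split_ifs <;> simp
      rw [h2, Herm.shift_eq hU hd, conjTranspose_mul, Matrix.mul_add, Matrix.add_mul]
      simp only [Matrix.mul_assoc]
    rw [h1]
    refine (PosDef.diagonal fun i => ?_).mul_mul_conjTranspose_same ?_
    · rw [Complex.zero_lt_real]
      split_ifs with h
      · rw [hlow i h]; norm_num
      · have := hlt i₀ i (by simp [hi₀]) (by omega)
        simpa using this
    · intro x y hxy
      have := congrArg (· ᵥ* Uᴴ) hxy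
      simpa [vecMul_vecMul, hU] using this

/-- Grushin reduction: for `B + V Vᴴ` positive definite, `B` has a two-dimensional kernel iff
`Vᴴ (B + V Vᴴ)⁻¹ V = 1`. -/
theorem conjTranspose_inv_mul_eq_one {B : Matrix (Fin n) (Fin n) ℂ}
    {V W : Matrix (Fin n) (Fin 2) ℂ} (hP : IsUnit (B + V * Vᴴ))
    (hW : Function.Injective W.mulVec) (hBW : B * W = 0) : Vᴴ * (B + V * Vᴴ)⁻¹ * V = 1 := by
  have hdet := (isUnit_iff_isUnit_det _).1 hP
  have h1 : (B + V * Vᴴ) * W = V * (Vᴴ * W) := by rw [Matrix.add_mul, hBW, zero_add, Matrix.mul_assoc]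
  have h2 : W = (B + V * Vᴴ)⁻¹ * V * (Vᴴ * W) := by
    rw [Matrix.mul_assoc, ← h1, ← Matrix.mul_assoc, nonsing_inv_mul _ hdet, Matrix.one_mul]
  have hY : IsUnit (Vᴴ * W) := by
    rw [← mulVec_injective_iff_isUnit]
    intro x y hxy
    apply hW
    rw [h2, ← mulVec_mulVec, ← mulVec_mulVec _ _ (Vᴴ * W)]
    exact congrArg _ hxy
  refine hY.mul_right_cancel ?_
  rw [Matrix.one_mul, Matrix.mul_assoc, Matrix.mul_assoc, ← Matrix.mul_assoc _ V, ← h2]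

/-- With `P = B + V Vᴴ` the witness is `W = P⁻¹ V`: the hypothesis says `Vᴴ W = 1`, whence `W` is
injective and `B W = P W - V (Vᴴ W) = V - V = 0`. -/
theorem exists_kernel_of_inv_mul_eq_one {B : Matrix (Fin n) (Fin n) ℂ}
    {V : Matrix (Fin n) (Fin 2) ℂ} (hP : IsUnit (B + V * Vᴴ))
    (h1 : Vᴴ * (B + V * Vᴴ)⁻¹ * V = 1) :
    ∃ W : Matrix (Fin n) (Fin 2) ℂ, Function.Injective W.mulVec ∧ B * W = 0 := by
  have hdet := (isUnit_iff_isUnit_det _).1 hP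
  have hVW : Vᴴ * ((B + V * Vᴴ)⁻¹ * V) = 1 := by rw [← Matrix.mul_assoc, h1]
  refine ⟨(B + V * Vᴴ)⁻¹ * V, fun x y hxy => ?_, ?_⟩
  · have h2 := congrArg (Vᴴ *ᵥ ·) hxy
    simpa only [mulVec_mulVec, hVW, one_mulVec] using h2
  · have h2 : (B + V * Vᴴ) * ((B + V * Vᴴ)⁻¹ * V) = V := by
      rw [← Matrix.mul_assoc, mul_nonsing_inv _ hdet, Matrix.one_mul]
    rw [Matrix.add_mul, Matrix.mul_assoc V, hVW, Matrix.mul_one] at h2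
    exact add_eq_right.1 h2

/-- The quadratic form is positive on a compact sphere, which is stable under small changes of the
matrix; homogeneity extends this to all nonzero vectors. -/
theorem eventually_posDef {B₀ : Matrix (Fin n) (Fin n) ℂ} (h : B₀.PosDef) :
    ∀ᶠ B in 𝓝 B₀, B.IsHermitian → B.PosDef := by
  have hK : IsCompact (Metric.sphere (0 : Fin n → ℂ) 1) := isCompact_sphere _ _
  have hc : Continuous fun z : Matrix (Fin n) (Fin n) ℂ × (Fin n → ℂ) =>
      (star z.2 ⬝ᵥ z.1 *ᵥ z.2).re :=
    Complex.continuous_re.comp (continuous_snd.star.dotProduct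
      (continuous_fst.matrix_mulVec continuous_snd))
  have := hK.eventually_forall_of_forall_eventually
    (P := fun B x => 0 < (star x ⬝ᵥ B *ᵥ x).re) (x₀ := B₀) fun x hx =>
      hc.continuousAt.eventually_const_lt (h.re_dotProduct_pos (ne_zero_of_mem_unit_sphere ⟨x, hx⟩))
  filter_upwards [this] with B hB hH
  refine PosDef.of_dotProduct_mulVec_pos hH fun x hx => ?_
  have him : (star x ⬝ᵥ B *ᵥ x).im = 0 := hH.im_star_dotProduct_mulVec_self x
  have hnorm : ‖x‖ ≠ 0 := norm_ne_zero_iff.2 hx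
  set y : Fin n → ℂ := ((‖x‖⁻¹ : ℝ) : ℂ) • x with hy
  have h1 := hB y (by simp [hy, norm_smul, hnorm])
  have h2 : star y ⬝ᵥ B *ᵥ y = ((‖x‖⁻¹ * ‖x‖⁻¹ : ℝ) : ℂ) * (star x ⬝ᵥ B *ᵥ x) := by
    rw [hy, star_smul, mulVec_smul, smul_dotProduct, dotProduct_smul, smul_smul, smul_eq_mul,
      Complex.star_def, Complex.conj_ofReal, Complex.ofReal_mul]
  rw [h2, Complex.re_ofReal_mul] at h1
  rw [Complex.lt_def]
  exact ⟨pos_of_mul_pos_right h1 (by positivity), him.symm⟩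

end Spectral

/-! ### Twofold degenerate matrices as a local graph. -/

section GroundGraph

open Matrix
open scoped ComplexOrder

attribute [local instance] Matrix.frobeniusNormedRing Matrix.frobeniusNormedAlgebra

variable {n : ℕ}

/-- `Herm.toMatrix` as a linear map. -/
def Herm.toMatrixLinear (n : ℕ) : Herm n →ₗ[ℝ] Matrix (Fin n) (Fin n) ℂ where
  toFun := Herm.toMatrix
  map_add' _ _ := rfl
  map_smul' _ _ := rfl

instance Herm.instFiniteDimensional (n : ℕ) : FiniteDimensional ℝ (Herm n) :=
  FiniteDimensional.of_injective (Herm.toMatrixLinear n) Subtype.val_injective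

theorem Herm.continuous_toMatrix : Continuous (Herm.toMatrix : Herm n → _) :=
  (Herm.toMatrixLinear n).continuous_of_finiteDimensional

/-- The traceless Hermitian `2 × 2` matrix with given Pauli coordinates. -/
def pauli : EuclideanSpace ℝ (Fin 3) →ₗ[ℝ] Matrix (Fin 2) (Fin 2) ℂ where
  toFun k := !![(k 2 : ℂ), k 0 - k 1 * Complex.I; k 0 + k 1 * Complex.I, -k 2]
  map_add' x y := by
    ext i j
    fin_cases i <;> fin_cases j <;> simp <;> ring
  map_smul' c x := by
    ext i j
    fin_cases i <;> fin_cases j <;> simp <;> ring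

theorem isHermitian_pauli (k : EuclideanSpace ℝ (Fin 3)) : (pauli k).IsHermitian := by
  ext i j
  fin_cases i <;> fin_cases j <;> simp [pauli, sub_eq_add_neg]

/-- The coordinates of a `2 × 2` matrix with respect to `1` and minus the Pauli matrices. -/
noncomputable def pauliCoord : Matrix (Fin 2) (Fin 2) ℂ →ₗ[ℝ] ℝ × EuclideanSpace ℝ (Fin 3) where
  toFun C := (((C 0 0).re + (C 1 1).re) / 2,
    !₂[-(C 1 0).re, -(C 1 0).im, ((C 1 1).re - (C 0 0).re) / 2])
  map_add' C D := by
    ext i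
    · simp
      ring
    · fin_cases i <;> simp <;> ring
  map_smul' c C := by
    ext i
    · simp
      ring
    · fin_cases i <;> simp
      ring

/-- The signs in `pauliCoord` are chosen for this identity, which makes the derivative of `grushin`
in `(λ, k)` the identity. -/
theorem pauliCoord_apply (l : ℝ) (k : EuclideanSpace ℝ (Fin 3)) :
    pauliCoord (l • 1 - pauli k) = (l, k) := by
  ext i
  · simp [pauliCoord, pauli]
  · fin_cases i <;> simp [pauliCoord, pauli]

/-- Hermitian symmetry recovers the entries that `pauliCoord` ignores, so four real equations
suffice for a 2×2 matrix equation. -/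
theorem eq_zero_of_pauliCoord_eq_zero {C : Matrix (Fin 2) (Fin 2) ℂ} (hC : C.IsHermitian)
    (h : pauliCoord C = 0) : C = 0 := by
  have h1 : ((C 0 0).re + (C 1 1).re) / 2 = 0 := congrArg Prod.fst h
  have h2 : -(C 1 0).re = 0 := congrArg (fun x => x.2 0) h
  have h3 : -(C 1 0).im = 0 := congrArg (fun x => x.2 1) h
  have h4 : ((C 1 1).re - (C 0 0).re) / 2 = 0 := congrArg (fun x => x.2 2) h
  have h5 : (C 0 0).im = 0 := Complex.conj_eq_iff_im.1 (hC.apply 0 0)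
  have h6 : (C 1 1).im = 0 := Complex.conj_eq_iff_im.1 (hC.apply 1 1)
  have h7 : C 1 0 = 0 := Complex.ext (by simpa using h2) (by simpa using h3)
  have h8 : C 0 1 = 0 := by rw [← hC.apply 0 1, h7, star_zero]
  ext i j
  fin_cases i <;> fin_cases j
  · exact Complex.ext (by simp; linarith) (by simpa using h5)
  · exact h8
  · exact h7
  · exact Complex.ext (by simp; linarith) (by simpa using h6)

/-- The perturbation `V (pauli k) Vᴴ`. -/
noncomputable def groundPerturbation (V : Matrix (Fin n) (Fin 2) ℂ) :
    EuclideanSpace ℝ (Fin 3) →L[ℝ] Herm n :=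
  LinearMap.toContinuousLinearMap
    { toFun := fun k => (⟨V * pauli k * Vᴴ, isHermitian_mul_mul_conjTranspose V
        (isHermitian_pauli k)⟩ : selfAdjoint.submodule ℝ (Matrix (Fin n) (Fin n) ℂ))
      map_add' := fun x y => Subtype.ext <|
        show V * pauli (x + y) * Vᴴ = V * pauli x * Vᴴ + V * pauli y * Vᴴ by
          rw [map_add, Matrix.mul_add, Matrix.add_mul]
      map_smul' := fun c x => Subtype.ext <|
        show V * pauli (c • x) * Vᴴ = c • (V * pauli x * Vᴴ) by
          rw [map_smul, Matrix.mul_smul, Matrix.smul_mul] }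

/-- The linear map `(A, λ, k) ↦ A + V (pauli k) Vᴴ - λ`. -/
noncomputable def shiftMap (V : Matrix (Fin n) (Fin 2) ℂ) :
    Herm n × (ℝ × EuclideanSpace ℝ (Fin 3)) →L[ℝ] Matrix (Fin n) (Fin n) ℂ :=
  LinearMap.toContinuousLinearMap
    { toFun := fun v => (v.1 + groundPerturbation V v.2.2).shift v.2.1
      map_add' := fun x y => by
        have h : ∀ A B : Herm n, (A + B).toMatrix = A.toMatrix + B.toMatrix := fun _ _ => rfl
        simp only [Herm.shift, h, Prod.fst_add, Prod.snd_add, map_add, Complex.ofReal_add, add_smul]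
        abel
      map_smul' := fun c x => by
        have h : ∀ A B : Herm n, (A + B).toMatrix = A.toMatrix + B.toMatrix := fun _ _ => rfl
        have h' : ∀ A : Herm n, (c • A).toMatrix = c • A.toMatrix := fun _ => rfl
        simp only [Herm.shift, h, h', Prod.smul_fst, Prod.smul_snd, map_smul, smul_eq_mul,
          Complex.ofReal_mul, RingHom.id_apply, smul_sub, smul_add, mul_smul]
        simp }

theorem shiftMap_apply (V : Matrix (Fin n) (Fin 2) ℂ)
    (v : Herm n × (ℝ × EuclideanSpace ℝ (Fin 3))) :
    shiftMap V v = (v.1 + groundPerturbation V v.2.2).shift v.2.1 := rfl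

/-- The linear map `N ↦ pauliCoord (Vᴴ N V)`. -/
noncomputable def compressedCoord (V : Matrix (Fin n) (Fin 2) ℂ) :
    Matrix (Fin n) (Fin n) ℂ →L[ℝ] ℝ × EuclideanSpace ℝ (Fin 3) :=
  LinearMap.toContinuousLinearMap
    { toFun := fun N => pauliCoord (Vᴴ * N * V)
      map_add' := fun x y => by rw [Matrix.mul_add, Matrix.add_mul, map_add]
      map_smul' := fun c x => by rw [Matrix.mul_smul, Matrix.smul_mul, map_smul, RingHom.id_apply] }

theorem compressedCoord_apply (V : Matrix (Fin n) (Fin 2) ℂ) (N : Matrix (Fin n) (Fin n) ℂ) :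
    compressedCoord V N = pauliCoord (Vᴴ * N * V) := rfl

/-- Its zeros are the `(A, λ, k)` for which `A + V (pauli k) Vᴴ - λ` has a two-dimensional
kernel. -/
noncomputable def grushin (V : Matrix (Fin n) (Fin 2) ℂ)
    (v : Herm n × (ℝ × EuclideanSpace ℝ (Fin 3))) : ℝ × EuclideanSpace ℝ (Fin 3) :=
  compressedCoord V (Ring.inverse (shiftMap V v + V * Vᴴ)) - pauliCoord 1

theorem contDiffAt_grushin {V : Matrix (Fin n) (Fin 2) ℂ}
    {v : Herm n × (ℝ × EuclideanSpace ℝ (Fin 3))} (hv : IsUnit (shiftMap V v + V * Vᴴ)) :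
    ContDiffAt ℝ ∞ (grushin V) v := by
  obtain ⟨b, hb⟩ := hv
  have h1 : ContDiffAt ℝ ∞ Ring.inverse (shiftMap V v + V * Vᴴ) := hb ▸ contDiffAt_ringInverse ℝ b
  have h2 : ContDiffAt ℝ ∞ (fun v => shiftMap V v + V * Vᴴ) v :=
    (shiftMap V).contDiff.contDiffAt.add contDiffAt_const
  have h3 : ContDiffAt ℝ ∞ (fun v => Ring.inverse (shiftMap V v + V * Vᴴ)) v :=
    ContDiffAt.comp (g := Ring.inverse) (f := fun v => shiftMap V v + V * Vᴴ) v h1 h2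
  have h4 : ContDiffAt ℝ ∞
      (fun v => compressedCoord V (Ring.inverse (shiftMap V v + V * Vᴴ))) v :=
    h3.continuousLinearMap_comp (compressedCoord V)
  exact h4.sub contDiffAt_const

theorem grushin_eq_zero {V W : Matrix (Fin n) (Fin 2) ℂ}
    {v : Herm n × (ℝ × EuclideanSpace ℝ (Fin 3))} (hv : IsUnit (shiftMap V v + V * Vᴴ))
    (hW : Function.Injective W.mulVec) (hv0 : shiftMap V v * W = 0) : grushin V v = 0 := by
  rw [grushin, compressedCoord_apply, ← nonsing_inv_eq_ringInverse,
    conjTranspose_inv_mul_eq_one hv hW hv0, sub_self]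

theorem exists_kernel_of_grushin_eq_zero {V : Matrix (Fin n) (Fin 2) ℂ}
    {v : Herm n × (ℝ × EuclideanSpace ℝ (Fin 3))} (hv : IsUnit (shiftMap V v + V * Vᴴ))
    (h0 : grushin V v = 0) :
    ∃ W : Matrix (Fin n) (Fin 2) ℂ, Function.Injective W.mulVec ∧ shiftMap V v * W = 0 := by
  refine exists_kernel_of_inv_mul_eq_one hv (sub_eq_zero.1 (eq_zero_of_pauliCoord_eq_zero ?_ ?_))
  · refine IsHermitian.sub (isHermitian_conjTranspose_mul_mul V (IsHermitian.inv ?_)) isHermitian_one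
    exact (Herm.isHermitian_shift _ _).add (isHermitian_mul_conjTranspose_self V)
  · rw [map_sub, nonsing_inv_eq_ringInverse]
    exact h0

theorem hasFDerivAt_grushin {V : Matrix (Fin n) (Fin 2) ℂ}
    {v : Herm n × (ℝ × EuclideanSpace ℝ (Fin 3))} {b : (Matrix (Fin n) (Fin n) ℂ)ˣ}
    (hb : shiftMap V v + V * Vᴴ = b) :
    HasFDerivAt (grushin V) (compressedCoord V ∘L
      (-((ContinuousLinearMap.mulLeftRight ℝ (Matrix (Fin n) (Fin n) ℂ)) ↑b⁻¹) ↑b⁻¹) ∘L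
        shiftMap V) v := by
  have h1 : HasFDerivAt Ring.inverse
      (-((ContinuousLinearMap.mulLeftRight ℝ (Matrix (Fin n) (Fin n) ℂ)) ↑b⁻¹) ↑b⁻¹)
      (shiftMap V v + V * Vᴴ) := hb ▸ hasFDerivAt_ringInverse b
  have h2 : HasFDerivAt (fun v => shiftMap V v + V * Vᴴ) (shiftMap V) v :=
    (shiftMap V).hasFDerivAt.add_const _
  have h3 := HasFDerivAt.comp (g := Ring.inverse) (f := fun v => shiftMap V v + V * Vᴴ) v h1 h2
  exact (HasFDerivAt.comp (g := compressedCoord V) v (compressedCoord V).hasFDerivAt h3).sub_const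
    (pauliCoord 1)

/-- At a degenerate matrix the derivative of `grushin` in the direction `(λ, k)` is the identity. -/
theorem fderiv_grushin_inr {A : Herm n} {l : ℝ} {V : Matrix (Fin n) (Fin 2) ℂ}
    (hVV : Vᴴ * V = 1) (hAV : A.shift l * V = 0) (hP : (A.shift l + V * Vᴴ).PosDef) :
    fderiv ℝ (grushin V) (A, (l, 0)) ∘L .inr ℝ (Herm n) (ℝ × EuclideanSpace ℝ (Fin 3)) =
      .id ℝ _ := by
  obtain ⟨b, hb⟩ := hP.isUnit
  have hb' : shiftMap V (A, (l, 0)) + V * Vᴴ = b := by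
    rw [shiftMap_apply, hb, map_zero, add_zero]
  -- On the ground space `A - l` vanishes and `V Vᴴ` is the identity, so `b` and `b⁻¹` fix `V`. The
  -- derivative `-b⁻¹ N b⁻¹` of the inverse thus compresses to `-Vᴴ N V = m - pauli k`.
  have hbV : (↑b⁻¹ : Matrix (Fin n) (Fin n) ℂ) * V = V := by
    have h4 : (b : Matrix (Fin n) (Fin n) ℂ) * V = V := by
      rw [hb, Matrix.add_mul, hAV, zero_add, Matrix.mul_assoc, hVV, Matrix.mul_one]
    conv_lhs => rw [← h4]
    rw [← Matrix.mul_assoc, Units.inv_mul, Matrix.one_mul]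
  have hVb : Vᴴ * (↑b⁻¹ : Matrix (Fin n) (Fin n) ℂ) = Vᴴ := by
    have h4 : Vᴴ * (b : Matrix (Fin n) (Fin n) ℂ) = Vᴴ := by
      rw [← conjTranspose_inj, conjTranspose_mul, conjTranspose_conjTranspose, hb,
        hP.isHermitian.eq, Matrix.add_mul, hAV, zero_add, Matrix.mul_assoc, hVV, Matrix.mul_one]
    conv_lhs => rw [← h4]
    rw [Matrix.mul_assoc, Units.mul_inv, Matrix.mul_one]
  rw [(hasFDerivAt_grushin hb').fderiv]
  refine ContinuousLinearMap.ext fun ⟨m, k⟩ => ?_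
  have h6 : shiftMap V (0, (m, k)) = V * pauli k * Vᴴ - (m : ℂ) • 1 := by
    rw [shiftMap_apply, zero_add]
    rfl
  have h8 : ∀ N : Matrix (Fin n) (Fin n) ℂ,
      (-((ContinuousLinearMap.mulLeftRight ℝ (Matrix (Fin n) (Fin n) ℂ)) ↑b⁻¹) ↑b⁻¹) N =
        -((↑b⁻¹ : Matrix (Fin n) (Fin n) ℂ) * N * (↑b⁻¹ : Matrix (Fin n) (Fin n) ℂ)) := fun N => by
    rw [_root_.neg_apply, ContinuousLinearMap.mulLeftRight_apply]
  refine (congrArg (compressedCoord V) (h8 (shiftMap V (0, (m, k))))).trans ?_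
  rw [compressedCoord_apply, h6, ContinuousLinearMap.id_apply, ← pauliCoord_apply]
  refine congrArg pauliCoord ?_
  generalize (↑b⁻¹ : Matrix (Fin n) (Fin n) ℂ) = R at hbV hVb ⊢
  have h7 : ∀ N : Matrix (Fin n) (Fin n) ℂ, Vᴴ * -(R * N * R) * V =
      -((Vᴴ * R) * N * (R * V)) := fun N => by
    simp only [Matrix.mul_assoc, Matrix.mul_neg, Matrix.neg_mul]
  rw [h7, hVb, hbV, Matrix.mul_sub, Matrix.sub_mul, neg_sub]
  congr 1
  · rw [Matrix.mul_smul, Matrix.smul_mul, Matrix.mul_one, hVV, Complex.coe_smul]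
  · rw [← Matrix.mul_assoc, ← Matrix.mul_assoc, hVV, Matrix.one_mul, Matrix.mul_assoc, hVV,
      Matrix.mul_one]

theorem continuous_shift_left (l : ℝ) : Continuous fun A : Herm n => A.shift l :=
  Herm.continuous_toMatrix.sub continuous_const

/-- The ground state energies of degenerate matrices near `A` are close to that of `A`. -/
theorem eventually_abs_groundEnergy_lt {A : Herm n} {l : ℝ} {V : Matrix (Fin n) (Fin 2) ℂ}
    (hVV : Vᴴ * V = 1) (hAV : A.shift l * V = 0) (hl : ∀ i, l ≤ ordEig A i) {η : ℝ} (hη : 0 < η) :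
    ∀ᶠ B in 𝓝 A, ∀ (m : ℝ) (W : Matrix (Fin n) (Fin 2) ℂ), (∀ i, m ≤ ordEig B i) → Wᴴ * W = 1 →
      B.shift m * W = 0 → |m - l| < η := by
  -- Two open conditions on `B` confine its ground energy `m`: positivity of `B - (l - η)`, tested
  -- on a ground vector of `B`, gives `m > l - η`; negativity of `B - (l + η)` on the ground vector
  -- `x` of `A` gives `m < l + η`.
  have hpos : (A.shift (l - η)).PosDef := by
    have h1 : A.shift (l - η) = A.shift l + (η : ℂ) • 1 := by
      simp only [Herm.shift, Complex.ofReal_sub, sub_smul]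
      abel
    rw [h1]
    exact PosDef.posSemidef_add (A.posSemidef_shift hl) (PosDef.one.smul (by simpa using hη))
  set x : Fin n → ℂ := V *ᵥ ![1, 0] with hx
  have hxx : star x ⬝ᵥ x = 1 := by
    rw [hx, star_mulVec, dotProduct_mulVec, vecMul_vecMul, hVV, vecMul_one]
    simp [dotProduct]
  have hxA : A.shift l *ᵥ x = 0 := by rw [hx, mulVec_mulVec, hAV, zero_mulVec]
  have hform : ∀ (B : Herm n) (a c : ℝ) (y : Fin n → ℂ), star y ⬝ᵥ B.shift a *ᵥ y =
      star y ⬝ᵥ B.shift c *ᵥ y + ((c - a : ℝ) : ℂ) * (star y ⬝ᵥ y) := by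
    intro B a c y
    have : B.shift a = B.shift c + ((c - a : ℝ) : ℂ) • 1 := by
      simp only [Herm.shift, Complex.ofReal_sub, sub_smul]
      abel
    rw [this, add_mulVec, dotProduct_add, smul_mulVec, one_mulVec, dotProduct_smul, smul_eq_mul]
  have h1 : ∀ᶠ B : Herm n in 𝓝 A, (B.shift (l - η)).PosDef :=
    ((continuous_shift_left (l - η)).continuousAt.eventually (eventually_posDef hpos)).mono
      fun B hB => hB (B.isHermitian_shift _)
  have h2 : ∀ᶠ B : Herm n in 𝓝 A, (star x ⬝ᵥ B.shift (l + η) *ᵥ x).re < 0 := by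
    have hc : Continuous fun B : Herm n => (star x ⬝ᵥ B.shift (l + η) *ᵥ x).re :=
      Complex.continuous_re.comp (continuous_const.dotProduct
        ((continuous_shift_left (l + η)).matrix_mulVec continuous_const))
    refine hc.continuousAt.eventually_lt_const ?_
    beta_reduce
    rw [hform A (l + η) l, hxA, hxx]
    simpa using hη
  filter_upwards [h1, h2] with B hB1 hB2 m W hm hWW hBW
  rw [abs_lt]
  constructor
  · set y : Fin n → ℂ := W *ᵥ ![1, 0] with hy
    have hyy : star y ⬝ᵥ y = 1 := by
      rw [hy, star_mulVec, dotProduct_mulVec, vecMul_vecMul, hWW, vecMul_one]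
      simp [dotProduct]
    have hy0 : y ≠ 0 := by
      intro h0
      simp [h0] at hyy
    have h3 := hB1.re_dotProduct_pos hy0
    rw [hform B (l - η) m, hyy, hy, mulVec_mulVec, hBW, zero_mulVec] at h3
    simp at h3
    linarith
  · have h3 := (B.posSemidef_shift hm).re_dotProduct_nonneg x
    rw [hform B (l + η) m, hxx] at hB2
    simp at h3 hB2
    linarith

/-- Twofold ground-state degenerate matrices locally form a graph over a complement of a
three-dimensional space. -/
theorem exists_isLocalGraph_groundDeg {A₀ : Herm n} (hA₀ : A₀ ∈ groundDeg n 2) :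
    ∃ U S κ δ, A₀ ∈ U ∧ IsLocalGraph (groundDeg n 2) U S κ δ := by
  obtain ⟨l₀, V, hl₀, hVV, hAV, hP⟩ := exists_groundSpace hA₀
  have : CompleteSpace (Herm n) := FiniteDimensional.complete ℝ _
  set u : Herm n × (ℝ × EuclideanSpace ℝ (Fin 3)) := (A₀, (l₀, 0)) with hu
  have hLu : shiftMap V u = A₀.shift l₀ := by
    rw [shiftMap_apply]
    simp [hu]
  have hPos : ∀ᶠ v in 𝓝 u, (shiftMap V v + V * Vᴴ).PosDef := by
    have hc : ContinuousAt (fun v => shiftMap V v + V * Vᴴ) u :=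
      ((shiftMap V).continuous.add continuous_const).continuousAt
    refine (hc.eventually (eventually_posDef (by simpa only [hLu] using hP))).mono fun v hv => hv ?_
    exact (Herm.isHermitian_shift _ _).add (isHermitian_mul_conjTranspose_self V)
  have hsm : ∀ᶠ v in 𝓝 u, ContDiffAt ℝ ∞ (grushin V) v :=
    hPos.mono fun v hv => contDiffAt_grushin hv.isUnit
  have hinj : ∀ W : Matrix (Fin n) (Fin 2) ℂ, Wᴴ * W = 1 → Function.Injective W.mulVec := by
    intro W hW x y hxy
    have h2 := congrArg (Wᴴ *ᵥ ·) hxy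
    simpa only [mulVec_mulVec, hW, one_mulVec] using h2
  have hf0 : grushin V u = 0 :=
    grushin_eq_zero (by rw [hLu]; exact hP.isUnit) (hinj V hVV) (by rw [hLu, hAV])
  obtain ⟨g, hgu, hgs, hgiff⟩ := exists_smooth_implicitFunction hsm
    (by rw [hu, fderiv_grushin_inr hVV hAV hP]; exact ⟨.refl ℝ _, rfl⟩)
  rw [hf0] at hgiff
  obtain ⟨U₁, T, hU₁, hAU₁, hT, hTu, hUT⟩ := mem_nhds_prod_iff'.1 (hPos.and hgiff)
  obtain ⟨η, hη, hηT⟩ := Metric.isOpen_iff.1 hT _ hTu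
  have hmemT : ∀ (m : ℝ) (k : EuclideanSpace ℝ (Fin 3)), |m - l₀| < η → ‖k‖ < η → (m, k) ∈ T := by
    intro m k hm hk
    refine hηT (Metric.mem_ball.2 ?_)
    rw [Prod.dist_eq]
    exact max_lt hm (by simpa using hk)
  have hgl : ∀ᶠ A in 𝓝 A₀, |(g A).1 - l₀| < η := by
    have hc : ContinuousAt (fun A => |(g A).1 - l₀|) A₀ :=
      ((continuous_fst.continuousAt.comp hgs.self_of_nhds.continuousAt).sub
        continuousAt_const).abs
    refine hc.eventually_lt_const ?_
    have : g A₀ = (l₀, 0) := hgu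
    simpa [this] using hη
  have hen : ∀ᶠ z in 𝓝 (A₀, (0 : EuclideanSpace ℝ (Fin 3))), ∀ (m : ℝ)
      (W : Matrix (Fin n) (Fin 2) ℂ), (∀ i, m ≤ ordEig (z.1 + groundPerturbation V z.2) i) →
      Wᴴ * W = 1 → (z.1 + groundPerturbation V z.2).shift m * W = 0 → |m - l₀| < η := by
    have hc : Continuous fun z : Herm n × EuclideanSpace ℝ (Fin 3) =>
        z.1 + groundPerturbation V z.2 :=
      continuous_fst.add ((groundPerturbation V).continuous.comp continuous_snd)
    have h1 := eventually_abs_groundEnergy_lt hVV hAV hl₀ hη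
    exact (hc.tendsto' (A₀, 0) A₀ (by simp)).eventually h1
  obtain ⟨U₂, T₂, hU₂, hAU₂, hT₂, hT₂0, hUT₂⟩ := mem_nhds_prod_iff'.1 hen
  obtain ⟨δ₂, hδ₂, hδT₂⟩ := Metric.isOpen_iff.1 hT₂ _ hT₂0
  obtain ⟨U₃, hU₃, hU₃o, hAU₃⟩ := mem_nhds_iff.1 (hgs.and hgl)
  refine ⟨U₁ ∩ U₂ ∩ U₃, groundPerturbation V, fun A => (g A).2, min η δ₂, ⟨⟨hAU₁, hAU₂⟩, hAU₃⟩,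
    (hU₁.inter hU₂).inter hU₃o, lt_min hη hδ₂, fun A hA => (hU₃ hA.2).1.snd, ?_⟩
  rintro A ⟨⟨hA1, hA2⟩, hA3⟩ k hk
  have hkη := hk.trans_le (min_le_left _ _)
  have hkδ := hk.trans_le (min_le_right _ _)
  constructor
  · intro hZ
    obtain ⟨m, W, hm, hWW, hAW, -⟩ := exists_groundSpace hZ
    -- The implicit function theorem only sees `λ` near `l₀`; the energy bound puts the ground
    -- energy of `A + S k` in that range.
    have hml := hUT₂ (show (A, k) ∈ U₂ ×ˢ T₂ from ⟨hA2, hδT₂ (by simpa using hkδ)⟩) m W hm hWW hAW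
    obtain ⟨h1, h2⟩ := hUT (show (A, (m, k)) ∈ U₁ ×ˢ T from ⟨hA1, hmemT m k hml hkη⟩)
    have h3 : g A = (m, k) := h2.1 (grushin_eq_zero h1.isUnit (hinj W hWW) hAW)
    rw [h3]
  · intro hg
    -- With `λ = (g A).1` the pair `(λ, k)` equals `g A`, so `grushin` vanishes there and yields the
    -- two-dimensional kernel.
    obtain ⟨h1, h2⟩ := hUT (show (A, ((g A).1, k)) ∈ U₁ ×ˢ T from
      ⟨hA1, hmemT _ k (hU₃ hA3).2 hkη⟩)
    obtain ⟨W, hW, hAW⟩ := exists_kernel_of_grushin_eq_zero h1.isUnit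
      (h2.2 (Prod.ext rfl hg))
    exact mem_groundDeg_of_posDef h1 hW hAW

end GroundGraph

/-! ### Stability and genericity of Weyl points. -/

theorem mainTheorem7 {n : ℕ} {M : Type*} [TopologicalSpace M] [T2Space M]
    [ChartedSpace (EuclideanSpace ℝ (Fin 3)) M] [IsManifold (𝓡 3) ∞ M]
    (H : M → Herm n) (hH : ContMDiff (𝓡 3) 𝓘(ℝ, Herm n) ∞ H)
    (p₀ : M) (hp₀ : H p₀ ∈ groundDeg n 2)
    (W₀ : Set M) (hW₀ : IsOpen W₀) (hpW₀ : p₀ ∈ W₀) (hcomp : IsCompact (closure W₀))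
    (hisol : {p | IsDegeneracyPoint H p} ∩ closure W₀ = {p₀}) :
    (IsWeylPoint H p₀ →
      ∀ (Ω : Set (M × ℝ)) (Ht : M × ℝ → Herm n),
        IsOpen Ω → closure W₀ ×ˢ {(0 : ℝ)} ⊆ Ω →
        ContMDiffOn ((𝓡 3).prod 𝓘(ℝ, ℝ)) 𝓘(ℝ, Herm n) ∞ Ht Ω →
        (∀ p : M, (p, (0 : ℝ)) ∈ Ω → Ht (p, 0) = H p) →
        ∃ ε : ℝ, 0 < ε ∧ W₀ ×ˢ Ioo (-ε) ε ⊆ Ω ∧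
          ∃ γ : ℝ → M, ContMDiffOn 𝓘(ℝ, ℝ) (𝓡 3) ∞ γ (Ioo (-ε) ε) ∧
            ∀ t ∈ Ioo (-ε) ε,
              {p ∈ W₀ | IsDegeneracyPoint (fun q => Ht (q, t)) p} = {γ t} ∧
              IsWeylPoint (fun q => Ht (q, t)) (γ t)) ∧
    (¬ IsWeylPoint H p₀ →
      ∀ ε : ℝ, 0 < ε → ∃ K : Herm n, ‖K‖ < ε ∧
        ∀ p ∈ W₀, IsDegeneracyPoint (fun q => H q + K) p →
          IsWeylPoint (fun q => H q + K) p) := by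
  obtain ⟨U, S, κ, δ, hU, h⟩ := exists_isLocalGraph_groundDeg hp₀
  have hiso : ∀ p ∈ closure W₀, H p ∈ closure (groundDeg n 2) → p = p₀ := fun p hp hpZ =>
    hisol.subset ⟨hpZ, hp⟩
  refine ⟨fun hW Ω Ht hΩ hWΩ hHt hH0 => ?_, fun _ ε hε => ?_⟩
  · exact h.stable_of_transverseAt hU hp₀ hW₀ hpW₀ hcomp hiso hW.2 hΩ
      (fun p hp => hWΩ ⟨hp, rfl⟩) hHt hH0
  · exact h.exists_translate_transverseAt hH hU hcomp hiso hε
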